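/- Conventions. Let $M$ be a monoid. For $a,b\in M$, $b$ is a left divisor of $a$ (and $a$ a right multiple of $b$) if $a=bd$ for some $d\in M$; right divisors and left multiples are defined symmetrically. A right lcm of $a$ and $b$ is a common right multiple $c$ of $a$ and $b$ such that every common right multiple of $a$ and $b$ is a right multiple of $c$; left lcms are defined symmetrically. A Garside element of $M$ is an element whose set of left divisors coincides with its set of right divisors and generates $M$. The monoid $M$ is a Garside monoid if $1$ is its only invertible element, it is left and right cancellative, every pair of elements has a left lcm and a right lcm, and $M$ has a Garside element. An element $h\in M$ is a root of $\Delta\in M$ if $h^q=\Delta$ for some integer $q\geq 1$. For monoids $M_1,M_2$ and $h_1\in M_1$, $h_2\in M_2$, the cyclic amalgamated free product $M_1\star_{h_1=h_2}M_2$ is the quotient of the free product of monoids $M_1\star M_2$ by the congruence generated by the relations $h_1^n=h_2^n$ $(n\in\mathbb N)$. Theorem. Let $M_1$ and $M_2$ be Garside monoids. Let $h_1\neq 1$ be a root of some Garside element of $M_1$ and let $h_2\neq 1$ be a root of some Garside element of $M_2$. Then the cyclic amalgamated free product $M_1\star_{h_1=h_2}M_2$ is a Garside monoid. Moreover, if each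 of $M_1$ and $M_2$ has a Garside element with finitely many divisors, then so does $M_1\star_{h_1=h_2}M_2$. -/

import Mathlib

namespace Garside

universe u v w

section Divisibility

/- In a monoid, `b ∣ a` means that `b` is a left divisor of `a` (`a = b * d` for some `d`), and
`b ∣ᵣ a` means that `b` is a right divisor of `a` (`a = d * b` for some `d`). -/

variable {M : Type u} [Monoid M]

/-- `c` is a right lcm of `a` and `b`: a common right multiple of `a` and `b` of which every
common right multiple of `a` and `b` is a right multiple. -/
def IsRightLcm (a b c : M) : Prop :=
  a ∣ c ∧ b ∣ c ∧ ∀ m : M, a ∣ m → b ∣ m → c ∣ m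

/-- `c` is a left lcm of `a` and `b`: a common left multiple of `a` and `b` of which every
common left multiple of `a` and `b` is a left multiple. -/
def IsLeftLcm (a b c : M) : Prop :=
  a ∣ᵣ c ∧ b ∣ᵣ c ∧ ∀ m : M, a ∣ᵣ m → b ∣ᵣ m → c ∣ᵣ m

/-- A Garside element: its left and right divisors coincide and generate the monoid. -/
structure IsGarsideElement (Δ : M) : Prop where
  divisors_coincide : {a : M | a ∣ Δ} = {a : M | a ∣ᵣ Δ}
  divisors_generate : Submonoid.closure {a : M | a ∣ Δ} = ⊤

/-- `h` is a root of some Garside element. -/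
def IsRootOfGarsideElement (h : M) : Prop :=
  ∃ q : ℕ, 0 < q ∧ IsGarsideElement (h ^ q)

end Divisibility

/-- A Garside monoid: conical, cancellative, with left lcms and right lcms of all pairs of
elements, and with a Garside element. -/
structure IsGarsideMonoid (M : Type u) [Monoid M] : Prop where
  conical : ∀ a : M, IsUnit a → a = 1
  cancellative : IsCancelMul M
  exists_leftLcm : ∀ a b : M, ∃ c : M, IsLeftLcm a b c
  exists_rightLcm : ∀ a b : M, ∃ c : M, IsRightLcm a b c
  exists_garsideElement : ∃ Δ : M, IsGarsideElement Δ

/-- Some Garside element has only finitely many divisors (left and right divisors of a Garside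
element are the same). -/
def HasFiniteGarsideElement (M : Type u) [Monoid M] : Prop :=
  ∃ Δ : M, IsGarsideElement Δ ∧ {a : M | a ∣ Δ}.Finite

section Amalgam

variable {M₁ : Type u} {M₂ : Type v} {H : Type w} [Monoid M₁] [Monoid M₂] [Monoid H]

/-- The congruence on the free product of `M₁` and `M₂` generated by the relations
`φ₁ h = φ₂ h` for `h` in `H`. -/
def amalgCon (φ₁ : H →* M₁) (φ₂ : H →* M₂) : Con (Monoid.Coprod M₁ M₂) :=
  conGen fun x y => ∃ h : H, x = Monoid.Coprod.inl (φ₁ h) ∧ y = Monoid.Coprod.inr (φ₂ h)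

/-- The amalgamated free product of `M₁` and `M₂` with respect to `H`, `φ₁` and `φ₂`. -/
abbrev AmalgamatedFreeProduct (φ₁ : H →* M₁) (φ₂ : H →* M₂) : Type (max u v) :=
  (amalgCon φ₁ φ₂).Quotient

/-- The cyclic amalgamated free product `M₁ ⋆_{h₁ = h₂} M₂`: here `H` is the infinite cyclic
monoid `Multiplicative ℕ`, whose generator is sent to `h₁` and to `h₂`. -/
abbrev CyclicAmalgam (h₁ : M₁) (h₂ : M₂) : Type (max u v) :=
  AmalgamatedFreeProduct (powersHom M₁ h₁) (powersHom M₂ h₂)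

end Amalgam

end Garside

/-!
The amalgam `M` of `M₁` and `M₂` along `h₁ = h₂` is studied through normal forms. Since every
element of `Mᵢ` divides a power of `hᵢ`, and `hᵢ ≠ 1`, each element is uniquely `t * hᵢ ^ k` with
`t` not right divisible by `hᵢ`. So `Mᵢ` is free as a set with the right action of `hᵢ`, and
both factors act on the alternating words `t₁ t₂ ⋯ tₙ h ^ k` (`Sides.act`). By the universal
property `M` acts on these words; each element of `M` acts on the empty word to give a word whose
product is the element itself, so elements are determined by their words. Consequently the factors embed, `h` is left
cancellable, and `t * y = s * z` with `s`, `t` in one factor and `y`, `z` starting in the other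
forces the two factorizations to differ by a power of `h` only (`Sides.Realization.amalgam`).

These facts are collected in `IsDecomposition`. They imply that the powers of `h` separate the two
sides: if `y` divides `z` and they start in different factors, then `y ∣ h ^ k ∣ z` for some `k`
(`IsDecomposition.separation`). To find the right lcm of `s` in a factor and `y` starting in the
other factor, one compares the least power `h ^ k` above `s` with the least power `h ^ l` above `y`,
if there is one: if `l ≤ k`, then the common multiples of `s` and `y` are those of `s` and `h ^ l`;
otherwise they are those of `h ^ k` and `y`. In the first case the lcm is taken in one factor; in
the second one, `h ^ k` lies in the factor where `y` starts, and the first letter of `y` can be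
split off. General right lcms follow by writing one of the two elements as a product, and left lcms
and right cancellation by passing to the opposite monoids.

If `h₁ ^ p` and `h₂ ^ q` are Garside elements, then `h ^ (p * q)` is quasi-central, and a
quasi-central element of a cancellative monoid whose divisors generate is a Garside element.
Conicality comes from the morphism to `{0, 1}` that is the indicator of `1` on both factors. For
finiteness, a divisor of `h ^ k` that is not a power of `h` is `t * y`, where `t ∣ h ^ k` lies in a
factor and is not a power of `h`, and `y` starts in the other factor; separation gives `y ∣ h ^ l`
with `l < k` (`IsDecomposition.finite_dvd_pow`).
-/

namespace Garside

universe u v w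

open MulOpposite

/-! ### Amalgams described inside a monoid -/

section Decomposition

variable {M : Type u} [Monoid M]

/-- Products that start on side `b`: powers of `h`, and products `t * y` of an element `t` of `S b`
which is not a power of `h` with a product `y` that starts on the other side. -/
inductive StartsOn (S : Bool → Submonoid M) (h : M) : Bool → M → Prop
  | pow (b : Bool) (k : ℕ) : StartsOn S h b (h ^ k)
  | mul {b : Bool} {t y : M} (ht : t ∈ S b) (hn : t ∉ Submonoid.powers h)
      (hy : StartsOn S h (!b) y) : StartsOn S h b (t * y)

theorem StartsOn.one (S : Bool → Submonoid M) (h : M) (b : Bool) : StartsOn S h b 1 := by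
  have := StartsOn.pow (S := S) (h := h) b 0
  rwa [pow_zero] at this

/-- An internal description of a cyclic amalgam: `M` is generated by the submonoids `S true` and
`S false`, which share the powers of `h`, and a factorization of an element as a product of an
element of `S b` and an element that starts on the other side is unique up to moving powers of `h`
across. -/
structure IsDecomposition (S : Bool → Submonoid M) (h : M) : Prop where
  conical : ∀ x y : M, x * y = 1 → x = 1
  left_cancel : ∀ x y z : M, x * y = x * z → y = z
  base_mem : ∀ b, h ∈ S b
  base_ne : h ≠ 1
  generate : Submonoid.closure (⋃ b, (S b : Set M)) = ⊤
  cofinal : ∀ b, ∀ t ∈ S b, ∃ k, ∃ d ∈ S b, h ^ k = t * d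
  exists_lcm : ∀ b, ∀ s ∈ S b, ∀ t ∈ S b, ∃ m ∈ S b,
    (∃ d ∈ S b, m = s * d) ∧ (∃ d ∈ S b, m = t * d) ∧
      ∀ z, (∃ d ∈ S b, z = s * d) → (∃ d ∈ S b, z = t * d) → m ∣ z
  amalgam : ∀ b, ∀ s ∈ S b, ∀ t ∈ S b, ∀ y z : M, StartsOn S h (!b) y → StartsOn S h (!b) z →
    s * y = t * z →
      ∃ r ∈ S b, ∃ i j : ℕ, s = r * h ^ i ∧ t = r * h ^ j ∧ h ^ i * y = h ^ j * z

namespace IsDecomposition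

variable {S : Bool → Submonoid M} {h : M}

theorem base_pow_mem (D : IsDecomposition S h) (b : Bool) (k : ℕ) : h ^ k ∈ S b :=
  Submonoid.pow_mem _ (D.base_mem b) k

theorem mem_powers_left_mul (D : IsDecomposition S h) {t : M} {k : ℕ}
    (ht : h ^ k * t ∈ Submonoid.powers h) : t ∈ Submonoid.powers h := by
  obtain ⟨n, hn : h ^ n = h ^ k * t⟩ := ht
  rcases le_total k n with hkn | hkn
  · refine ⟨n - k, D.left_cancel (h ^ k) _ _ ?_⟩
    change h ^ k * h ^ (n - k) = _
    rw [← pow_add, Nat.add_sub_cancel' hkn, hn]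
  · have h1 : h ^ n * 1 = h ^ n * (h ^ (k - n) * t) := by
      rw [mul_one, ← mul_assoc, ← pow_add, Nat.add_sub_cancel' hkn, hn]
    have h2 := (D.left_cancel _ _ _ h1).symm
    have h3 := D.conical _ _ h2
    rw [h3, one_mul] at h2
    exact h2 ▸ Submonoid.one_mem _

/-- The products `t * y`, with `t` in `S b` and `y` starting on the other side, are stable under
left multiplication by either side. -/
theorem exists_eq_mul_aux (D : IsDecomposition S h) {b c : Bool} {s t y : M} (hs : s ∈ S c)
    (ht : t ∈ S b) (hy : StartsOn S h (!b) y) :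
    ∃ t' ∈ S b, ∃ y', StartsOn S h (!b) y' ∧ s * (t * y) = t' * y' := by
  rcases eq_or_ne c b with rfl | hcb
  · exact ⟨s * t, mul_mem hs ht, y, hy, by rw [mul_assoc]⟩
  obtain rfl : c = !b := by cases b <;> cases c <;> simp_all
  by_cases htp : t ∈ Submonoid.powers h
  · obtain ⟨k, rfl : h ^ k = t⟩ := htp
    have hs' : s * h ^ k ∈ S (!b) := mul_mem hs (D.base_pow_mem _ k)
    rw [← mul_assoc]
    generalize s * h ^ k = s' at hs'
    by_cases hsp : s' ∈ Submonoid.powers h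
    · obtain ⟨m, rfl⟩ := hsp
      exact ⟨_, D.base_pow_mem b m, y, hy, rfl⟩
    generalize hc : (!b) = c at *
    cases hy with
    | pow _ m =>
      by_cases hp : s' * h ^ m ∈ Submonoid.powers h
      · obtain ⟨l, hl⟩ := hp
        exact ⟨1, one_mem _, _, .pow _ l, by rw [one_mul]; exact hl.symm⟩
      · exact ⟨1, one_mem _, (s' * h ^ m) * h ^ 0,
          .mul (mul_mem hs' (D.base_pow_mem _ m)) hp (.pow _ 0), by simp⟩
    | @mul _ t₁ y₁ ht₁ hn₁ hy₁ =>
      by_cases hp : s' * t₁ ∈ Submonoid.powers h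
      · obtain ⟨l, hl : h ^ l = _⟩ := hp
        obtain rfl : b = !c := by cases b <;> cases c <;> simp_all
        rw [← mul_assoc, ← hl]
        have : ∃ t' ∈ S (!c), ∃ y', StartsOn S h c y' ∧ y₁ = t' * y' := by
          cases hy₁ with
          | pow _ k => exact ⟨_, D.base_pow_mem _ k, 1, StartsOn.one S h c, by simp⟩
          | mul ht hn hy => exact ⟨_, ht, _, by simpa using hy, rfl⟩
        obtain ⟨t', ht', y', hy', rfl⟩ := this
        exact ⟨h ^ l * t', mul_mem (D.base_pow_mem _ l) ht', y', hy', by rw [mul_assoc]⟩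
      · exact ⟨1, one_mem _, _, .mul (mul_mem hs' ht₁) hp hy₁, by simp [mul_assoc]⟩
  · have hty : StartsOn S h b (t * y) := .mul ht htp hy
    by_cases hsp : s ∈ Submonoid.powers h
    · obtain ⟨k, rfl⟩ := hsp
      exact ⟨h ^ k * t, mul_mem (D.base_pow_mem _ k) ht, y, hy, by simp [mul_assoc]⟩
    · exact ⟨1, one_mem _, _, .mul hs hsp (by simpa using hty), by simp⟩

theorem mem_induction (D : IsDecomposition S h) {p : M → Prop} (one : p 1)
    (mul : ∀ b, ∀ s ∈ S b, ∀ x, p x → p (s * x)) (x : M) : p x := by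
  have hx : x ∈ Submonoid.closure (⋃ b, (S b : Set M)) := D.generate ▸ Submonoid.mem_top x
  induction hx using Submonoid.closure_induction_left with
  | one => exact one
  | mul_left s hs y _ ih =>
    obtain ⟨b, hb⟩ := Set.mem_iUnion.1 hs
    exact mul b s hb y ih

theorem exists_eq_mul (D : IsDecomposition S h) (b : Bool) (x : M) :
    ∃ t ∈ S b, ∃ y, StartsOn S h (!b) y ∧ x = t * y := by
  induction x using D.mem_induction with
  | one => exact ⟨1, one_mem _, 1, StartsOn.one S h (!b), by simp⟩
  | mul c s hs x ih =>
    obtain ⟨t, ht, y, hy, rfl⟩ := ih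
    exact D.exists_eq_mul_aux hs ht hy

theorem startsOn_pow_mul (D : IsDecomposition S h) {b : Bool} {y : M} (hy : StartsOn S h b y)
    (k : ℕ) : StartsOn S h b (h ^ k * y) := by
  cases hy with
  | pow _ m => rw [← pow_add]; exact .pow _ _
  | mul ht hn hy =>
    rw [← mul_assoc]
    exact .mul (mul_mem (D.base_pow_mem _ k) ht) (fun hp => hn (D.mem_powers_left_mul hp)) hy

theorem startsOn_or (D : IsDecomposition S h) (b : Bool) (x : M) :
    StartsOn S h b x ∨ StartsOn S h (!b) x := by
  obtain ⟨t, ht, y, hy, rfl⟩ := D.exists_eq_mul b x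
  by_cases hp : t ∈ Submonoid.powers h
  · obtain ⟨k, rfl⟩ := hp
    exact .inr (D.startsOn_pow_mul hy k)
  · exact .inl (.mul ht hp hy)

/-- An element of `S b` that sends a product starting on the other side to one starting on the
other side is a power of `h`. -/
theorem mem_powers_of_startsOn (D : IsDecomposition S h) {b : Bool} {t y : M} (ht : t ∈ S b)
    (hy : StartsOn S h (!b) y) (hty : StartsOn S h (!b) (t * y)) : t ∈ Submonoid.powers h := by
  obtain ⟨r, -, i, j, h1, h2, -⟩ := D.amalgam b t ht 1 (one_mem _) y _ hy hty (by rw [one_mul])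
  exact ⟨i, by rw [h1, D.conical _ _ h2.symm, one_mul]⟩

/-- If `s` and `t` lie on the same side, then `s` divides `t * z`, where `z` starts on the other
side, only if it divides the product of `t` with some power of `h` that divides `z`. -/
theorem exists_pow_of_dvd_mul (D : IsDecomposition S h) {b : Bool} {s t z : M} (hs : s ∈ S b)
    (ht : t ∈ S b) (hz : StartsOn S h (!b) z) (hdvd : s ∣ t * z) :
    ∃ k, h ^ k ∣ z ∧ ∃ d ∈ S b, t * h ^ k = s * d := by
  obtain ⟨x, hx⟩ := hdvd
  obtain ⟨x₁, hx₁, y, hy, rfl⟩ := D.exists_eq_mul b x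
  rw [← mul_assoc] at hx
  obtain ⟨r, -, i, j, h1, h2, h3⟩ := D.amalgam b _ ht _ (mul_mem hs hx₁) _ _ hz hy hx
  rcases le_total i j with hij | hij
  · refine ⟨j - i, ⟨y, D.left_cancel (h ^ i) _ _ ?_⟩, x₁, hx₁, ?_⟩
    · rw [h3, ← mul_assoc, ← pow_add, Nat.add_sub_cancel' hij]
    · rw [h2, h1, mul_assoc, ← pow_add, Nat.add_sub_cancel' hij]
  · refine ⟨0, by simp, x₁ * h ^ (i - j), mul_mem hx₁ (D.base_pow_mem _ _), ?_⟩
    rw [pow_zero, mul_one, ← mul_assoc, h2, h1, mul_assoc, ← pow_add, Nat.add_sub_cancel' hij]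

theorem exists_pow_of_dvd (D : IsDecomposition S h) {b : Bool} {s z : M} (hs : s ∈ S b)
    (hz : StartsOn S h (!b) z) (hdvd : s ∣ z) : ∃ k, s ∣ h ^ k ∧ h ^ k ∣ z := by
  obtain ⟨k, hk, d, -, hd⟩ := D.exists_pow_of_dvd_mul hs (one_mem _) hz (by rwa [one_mul])
  exact ⟨k, ⟨d, by rw [← hd, one_mul]⟩, hk⟩

/-- Powers of `h` separate the two sides: a divisibility between products that start on different
sides passes through a power of `h`. -/
theorem separation (D : IsDecomposition S h) {b : Bool} {y z : M} (hy : StartsOn S h b y)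
    (hz : StartsOn S h (!b) z) (hdvd : y ∣ z) : ∃ k, y ∣ h ^ k ∧ h ^ k ∣ z := by
  induction hy generalizing z with
  | pow b k => exact ⟨k, dvd_rfl, hdvd⟩
  | @mul b t y ht hn hy ih =>
    obtain ⟨x, rfl⟩ := hdvd
    rw [mul_assoc] at hz ⊢
    rcases D.startsOn_or b (y * x) with hw | hw
    · obtain ⟨k, hyk, hk⟩ := ih (by simpa using hw) (dvd_mul_right y x)
      obtain ⟨l, hl, hl'⟩ := D.exists_pow_of_dvd (mul_mem ht (D.base_pow_mem b k)) hz
        (mul_dvd_mul_left t hk)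
      exact ⟨l, (mul_dvd_mul_left t hyk).trans hl, hl'⟩
    · exact absurd (D.mem_powers_of_startsOn ht hw hz) hn

end IsDecomposition

/-! ### Right lcms and divisors in an amalgam -/

section Lcm

theorem IsRightLcm.symm {a b c : M} (hc : IsRightLcm a b c) : IsRightLcm b a c :=
  ⟨hc.2.1, hc.1, fun m hb ha => hc.2.2 m ha hb⟩

/-- The element `a'` can replace its multiple `a` if both have the same common multiples with `b`. -/
theorem IsRightLcm.congr_left {a a' b c : M} (hc : IsRightLcm a b c) (haa : a' ∣ a)
    (ha : ∀ z, a' ∣ z → b ∣ z → a ∣ z) : IsRightLcm a' b c :=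
  ⟨haa.trans hc.1, hc.2.1, fun z hz hb => hc.2.2 z (ha z hz hb) hb⟩

/-- The right lcm of `s` and `t * y` is computed in two steps, provided that `t` can be
cancelled. -/
theorem exists_isRightLcm_mul {s t y : M} (ht : ∀ u v, t * u = t * v → u = v)
    (h₁ : ∃ c, IsRightLcm s t c) (h₂ : ∀ s', IsRightLcm s t (t * s') → ∃ c, IsRightLcm s' y c) :
    ∃ c, IsRightLcm s (t * y) c := by
  obtain ⟨_, hs⟩ := h₁
  obtain ⟨s', rfl⟩ := hs.2.1
  obtain ⟨n, hn⟩ := h₂ s' hs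
  have key {u v : M} (huv : t * u ∣ t * v) : u ∣ v := by
    obtain ⟨x, hx⟩ := huv
    exact ⟨x, ht _ _ (by rw [hx, mul_assoc])⟩
  refine ⟨t * n, hs.1.trans (mul_dvd_mul_left t hn.1), mul_dvd_mul_left t hn.2.1, ?_⟩
  rintro z hsz ⟨x, rfl⟩
  have htz : t ∣ t * y * x := ⟨y * x, mul_assoc _ _ _⟩
  have h3 := hs.2.2 _ hsz htz
  rw [mul_assoc] at h3 ⊢
  exact mul_dvd_mul_left t (hn.2.2 _ (key h3) (dvd_mul_right y x))

end Lcm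

namespace IsDecomposition

variable {S : Bool → Submonoid M} {h : M}

/-- A right lcm taken inside `S b` is a right lcm in the whole monoid. -/
theorem exists_isRightLcm_of_mem (D : IsDecomposition S h) {b : Bool} {s t : M} (hs : s ∈ S b)
    (ht : t ∈ S b) : ∃ c ∈ S b, IsRightLcm s t c := by
  obtain ⟨m, hm, ⟨d, -, hd⟩, ⟨e, -, he⟩, hmin⟩ := D.exists_lcm b s hs t ht
  refine ⟨m, hm, ⟨d, hd⟩, ⟨e, he⟩, fun z hsz htz => ?_⟩
  obtain ⟨u, hu, z', hz', rfl⟩ := D.exists_eq_mul b z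
  obtain ⟨i, hi, d, hd, hd'⟩ := D.exists_pow_of_dvd_mul hs hu hz' hsz
  obtain ⟨j, hj, e, he, he'⟩ := D.exists_pow_of_dvd_mul ht hu hz' htz
  rcases le_total i j with hij | hij
  · refine (hmin (u * h ^ j) ⟨d * h ^ (j - i), mul_mem hd (D.base_pow_mem _ _), ?_⟩
      ⟨e, he, he'⟩).trans (mul_dvd_mul_left u hj)
    rw [← mul_assoc, ← hd', mul_assoc, ← pow_add, Nat.add_sub_cancel' hij]
  · refine (hmin (u * h ^ i) ⟨d, hd, hd'⟩ ⟨e * h ^ (i - j), mul_mem he (D.base_pow_mem _ _), ?_⟩).trans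
      (mul_dvd_mul_left u hi)
    rw [← mul_assoc, ← he', mul_assoc, ← pow_add, Nat.add_sub_cancel' hij]

theorem mem_of_mul_mem (D : IsDecomposition S h) {b : Bool} {s x : M} (hs : s ∈ S b)
    (hsx : s * x ∈ S b) : x ∈ S b := by
  obtain ⟨k, ⟨y, hy⟩, d, hd, hd'⟩ := D.exists_pow_of_dvd_mul hs hsx
    (StartsOn.one S h (!b)) (z := 1) ⟨x, by rw [mul_one]⟩
  have hk := D.conical _ _ hy.symm
  rw [hk, mul_one] at hd'
  rwa [D.left_cancel _ _ _ hd']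

open Classical in
/-- By induction on the product `y`: its right lcm with an element of a side exists. -/
theorem exists_isRightLcm_of_startsOn (D : IsDecomposition S h) {b : Bool} {y : M}
    (hy : StartsOn S h b y) (c : Bool) {s : M} (hs : s ∈ S c) : ∃ m, IsRightLcm s y m := by
  induction hy generalizing c s with
  | pow b k => exact (D.exists_isRightLcm_of_mem hs (D.base_pow_mem c k)).imp fun _ => And.right
  | @mul b t y ht hn hy ih =>
    -- on the side of `t`, first the lcm with `t` is taken
    have same {s : M} (hs : s ∈ S b) : ∃ m, IsRightLcm s (t * y) m := by
      obtain ⟨m, hm, hm'⟩ := D.exists_isRightLcm_of_mem hs ht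
      refine exists_isRightLcm_mul (D.left_cancel t) ⟨m, hm'⟩ fun s' hs' => ih b ?_
      obtain ⟨x, rfl⟩ := hs'.2.2 m hm'.1 hm'.2.1
      obtain ⟨x', hx'⟩ := hm'.2.2 _ hs'.1 hs'.2.1
      have hxx : x * x' = 1 := D.left_cancel (t * s') _ _ (by rw [← mul_assoc, ← hx', mul_one])
      rw [D.conical _ _ hxx, mul_one] at hm
      exact D.mem_of_mul_mem ht hm
    rcases eq_or_ne c b with rfl | hcb
    · exact same hs
    obtain rfl : c = !b := by cases b <;> cases c <;> simp_all
    have hty : StartsOn S h b (t * y) := .mul ht hn hy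
    have hex : ∃ k, s ∣ h ^ k := by
      obtain ⟨k, d, -, hd⟩ := D.cofinal _ s hs
      exact ⟨k, d, hd⟩
    -- a common multiple `z` is a multiple of the least power of `h` above `s`, or of one above
    -- `t * y`, according to the side on which `z` starts
    have hsz {z : M} (hz : StartsOn S h b z) (hsz : s ∣ z) : h ^ Nat.find hex ∣ z := by
      obtain ⟨k, hk, hk'⟩ := D.exists_pow_of_dvd hs (by simpa using hz) hsz
      exact (pow_dvd_pow h (Nat.find_min' hex hk)).trans hk'
    by_cases hl : ∃ l, l ≤ Nat.find hex ∧ t * y ∣ h ^ l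
    · have hl₁ := Nat.find_spec hl
      obtain ⟨m, hm, hm'⟩ := D.exists_isRightLcm_of_mem hs (D.base_pow_mem (!b) (Nat.find hl))
      refine ⟨m, (hm'.symm.congr_left hl₁.2 fun z hyz hsz' => ?_).symm⟩
      rcases D.startsOn_or b z with hz | hz
      · exact (pow_dvd_pow h hl₁.1).trans (hsz hz hsz')
      · obtain ⟨l, hyl, hlz⟩ := D.separation hty hz hyz
        refine (pow_dvd_pow h ?_).trans hlz
        rcases le_total l (Nat.find hex) with hle | hle
        · exact Nat.find_min' hl ⟨hle, hyl⟩
        · exact hl₁.1.trans hle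
    · obtain ⟨m, hm⟩ := same (D.base_pow_mem b (Nat.find hex))
      refine ⟨m, hm.congr_left (Nat.find_spec hex) fun z hsz' hyz => ?_⟩
      rcases D.startsOn_or b z with hz | hz
      · exact hsz hz hsz'
      · obtain ⟨l, hyl, hlz⟩ := D.separation hty hz hyz
        exact (pow_dvd_pow h (le_of_not_ge fun hle => hl ⟨l, hle, hyl⟩)).trans hlz

theorem exists_isRightLcm (D : IsDecomposition S h) (x y : M) : ∃ c, IsRightLcm x y c := by
  induction y using D.mem_induction generalizing x with
  | one => exact ⟨x, dvd_rfl, one_dvd x, fun _ hx _ => hx⟩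
  | mul b s hs y ih =>
    refine exists_isRightLcm_mul (D.left_cancel s) ?_ fun x' _ => ih x'
    rcases D.startsOn_or b x with hx | hx
    · exact (D.exists_isRightLcm_of_startsOn hx b hs).imp fun _ => IsRightLcm.symm
    · exact (D.exists_isRightLcm_of_startsOn hx b hs).imp fun _ => IsRightLcm.symm

/-- Powers of `h` have finitely many divisors in the amalgam as soon as they have finitely many
divisors on each side. -/
theorem finite_dvd_pow (D : IsDecomposition S h)
    (hfin : ∀ b k, {t : M | t ∈ S b ∧ t ∣ h ^ k}.Finite) (k : ℕ) :
    {y : M | y ∣ h ^ k}.Finite := by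
  -- this makes the exponent drop when a factor that is not a power of `h` is split off
  have one_of {b : Bool} {t e : M} {k : ℕ} (ht : t ∈ S b) (hte : h ^ k = t * h ^ k * e) :
      t = 1 := by
    -- all powers of `t` divide `h ^ k`, so two of them agree
    have hpow : ∀ n, h ^ k = t ^ n * h ^ k * e ^ n := by
      intro n
      induction n with
      | zero => simp
      | succ n ih =>
        rw [pow_succ, pow_succ' e]
        conv_lhs => rw [ih, hte]
        simp only [mul_assoc]
    obtain ⟨m, n, hmn, hlt⟩ : ∃ m n, t ^ m = t ^ n ∧ m < n := by
      obtain ⟨m, -, n, -, hne, heq⟩ := Set.infinite_univ.exists_ne_map_eq_of_mapsTo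
        (f := fun n : ℕ => t ^ n) (t := {t : M | t ∈ S b ∧ t ∣ h ^ k})
        (fun n _ => ⟨pow_mem ht n, h ^ k * e ^ n, by rw [← mul_assoc]; exact hpow n⟩) (hfin b k)
      rcases lt_or_gt_of_ne hne with hlt | hlt
      · exact ⟨m, n, heq, hlt⟩
      · exact ⟨n, m, heq.symm, hlt⟩
    obtain ⟨d, rfl⟩ := Nat.exists_eq_add_of_lt hlt
    rw [add_assoc, pow_add] at hmn
    have h1 : 1 = t ^ (d + 1) := D.left_cancel (t ^ m) _ _ (by rw [mul_one]; exact hmn)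
    rw [pow_succ'] at h1
    exact D.conical _ _ h1.symm
  induction k using Nat.strong_induction_on with
  | _ k ih =>
    have hF : (⋃ l ∈ Set.Iio k, {y : M | y ∣ h ^ l}).Finite :=
      (Set.finite_Iio k).biUnion fun l hl => ih l hl
    have hG : (⋃ b : Bool, {t : M | t ∈ S b ∧ t ∣ h ^ k}).Finite :=
      Set.finite_iUnion fun b => hfin b k
    refine (hG.union (hG.image2 (· * ·) hF)).subset fun z hz => ?_
    have hcases : ∀ b, StartsOn S h b z → z ∈ (⋃ b : Bool, {t : M | t ∈ S b ∧ t ∣ h ^ k}) ∪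
        Set.image2 (· * ·) (⋃ b : Bool, {t : M | t ∈ S b ∧ t ∣ h ^ k})
          (⋃ l ∈ Set.Iio k, {y : M | y ∣ h ^ l}) := by
      intro b hb
      cases hb with
      | pow _ m => exact .inl (Set.mem_iUnion.2 ⟨b, D.base_pow_mem b m, hz⟩)
      | @mul _ t y ht hn hy =>
        have htk : t ∣ h ^ k := (dvd_mul_right t y).trans hz
        obtain ⟨x, hx⟩ := hz
        rw [mul_assoc] at hx
        -- the cofactor of `t` starts on the side of `t`, so a power of `h` lies above `y`
        have hyx : StartsOn S h b (y * x) := by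
          rcases D.startsOn_or b (y * x) with hw | hw
          · exact hw
          · exact absurd (D.mem_powers_of_startsOn ht hw (hx ▸ .pow _ k)) hn
        obtain ⟨l, hyl, c, hc⟩ := D.separation hy (by simpa using hyx) (dvd_mul_right y x)
        refine .inr ⟨t, Set.mem_iUnion.2 ⟨b, ht, htk⟩, y, ?_, rfl⟩
        refine Set.mem_biUnion (x := l) (Set.mem_Iio.2 (lt_of_not_ge fun hkl => ?_)) hyl
        obtain ⟨m, rfl⟩ := Nat.exists_eq_add_of_le hkl
        rw [hc, pow_add] at hx
        have := one_of (e := h ^ m * c) ht (by simpa only [mul_assoc] using hx)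
        exact hn (this ▸ one_mem _)
    rcases D.startsOn_or true z with hb | hb
    · exact hcases _ hb
    · exact hcases _ hb

end IsDecomposition
end Decomposition

/-! ### Normal words for a cyclic amalgam -/

section Words

/-- Two monoids, given as submonoids `S true` and `S false` of a common monoid `P`, with elements
`h true` and `h false`. Every `a` in `S b` is written as `rep b a * h b ^ exp b a`, where `rep b a`
depends only on the orbit of `a` under right multiplication by `h b`. -/
structure Sides (P : Type u) [Monoid P] where
  S : Bool → Submonoid P
  h : Bool → P
  rep : Bool → P → P
  exp : Bool → P → ℕ
  h_mem : ∀ b, h b ∈ S b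
  rep_mem : ∀ b, ∀ a ∈ S b, rep b a ∈ S b
  rep_mul_pow : ∀ b, ∀ a ∈ S b, rep b a * h b ^ exp b a = a
  rep_mul : ∀ b a k, rep b (a * h b ^ k) = rep b a
  exp_mul : ∀ b a k, exp b (a * h b ^ k) = exp b a + k
  rep_one : ∀ b, rep b 1 = 1
  rep_eq_one : ∀ b a k, rep b (h b ^ k * a) = 1 → rep b a = 1
  pow_left_cancel : ∀ b k a a', h b ^ k * a = h b ^ k * a' → a = a'

/-- Words `t₁ t₂ ⋯ tₙ h ^ k`, where each letter carries the side to which it belongs. -/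
inductive Word (P : Type u) : Type u
  | base (k : ℕ) : Word P
  | cons (b : Bool) (t : P) (w : Word P) : Word P

namespace Sides

variable {P : Type u}

/-- The side of the first letter of a word. -/
def head : Word P → Option Bool
  | .base _ => none
  | .cons b _ _ => some b

/-- What remains of a word when its first letter is removed, if it is on side `b`. -/
def rest (b : Bool) : Word P → Word P
  | .base k => .base k
  | .cons c t w => if c = b then w else .cons c t w

theorem rest_of_head {b : Bool} {w : Word P} (hw : head w ≠ some b) : rest b w = w := by
  cases w with
  | base k => rfl
  | cons c t w => exact if_neg fun h => hw (congrArg some h)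

variable [Monoid P] (N : Sides P)

theorem rep_rep {b : Bool} {a : P} (ha : a ∈ N.S b) : N.rep b (N.rep b a) = N.rep b a := by
  conv_rhs => rw [← N.rep_mul_pow b a ha, N.rep_mul]

theorem exp_rep {b : Bool} {a : P} (ha : a ∈ N.S b) : N.exp b (N.rep b a) = 0 := by
  have h1 := N.exp_mul b (N.rep b a) (N.exp b a)
  rw [N.rep_mul_pow b a ha] at h1
  lia

theorem rep_mul_rep {b : Bool} {a : P} (c : P) (ha : a ∈ N.S b) :
    N.rep b (c * N.rep b a) = N.rep b (c * a) := by
  conv_rhs => rw [← N.rep_mul_pow b a ha, ← mul_assoc, N.rep_mul]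

theorem exp_mul_rep {b : Bool} {a : P} (c : P) (ha : a ∈ N.S b) :
    N.exp b (c * N.rep b a) + N.exp b a = N.exp b (c * a) := by
  conv_rhs => rw [← N.rep_mul_pow b a ha, ← mul_assoc, N.exp_mul]

theorem rep_pow (b : Bool) (k : ℕ) : N.rep b (N.h b ^ k) = 1 := by
  simpa [N.rep_one] using N.rep_mul b 1 k

theorem exp_one (b : Bool) : N.exp b 1 = 0 := by
  have h1 := N.exp_rep (one_mem (N.S b))
  rwa [N.rep_one] at h1

theorem exp_pow (b : Bool) (k : ℕ) : N.exp b (N.h b ^ k) = k := by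
  simpa [N.exp_one] using N.exp_mul b 1 k

theorem pow_mem (b : Bool) (k : ℕ) : N.h b ^ k ∈ N.S b := Submonoid.pow_mem _ (N.h_mem b) k

/-- Normal words: the letters are nontrivial orbit representatives, alternately on the two sides. -/
def Normal : Word P → Prop
  | .base _ => True
  | .cons b t w => t ∈ N.S b ∧ N.rep b t = t ∧ t ≠ 1 ∧ head w ≠ some b ∧ Normal w

/-- Left multiplication of a word by the `j`-th power of the amalgamated generator: the power is
moved through the word from left to right, with each letter replaced by the representative of its
new orbit. -/
def powMul : ℕ → Word P → Word P
  | j, .base k => .base (j + k)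
  | j, .cons b t w => .cons b (N.rep b (N.h b ^ j * t)) (powMul (N.exp b (N.h b ^ j * t)) w)

theorem head_powMul (j : ℕ) (w : Word P) : head (N.powMul j w) = head w := by
  cases w <;> rfl

theorem normal_powMul {w : Word P} (hw : N.Normal w) (j : ℕ) : N.Normal (N.powMul j w) := by
  induction w generalizing j with
  | base k => trivial
  | cons b t w ih =>
    obtain ⟨h1, h2, h3, h4, h5⟩ := hw
    have hm := mul_mem (N.pow_mem b j) h1
    refine ⟨N.rep_mem b _ hm, N.rep_rep hm, fun h => h3 ?_, ?_, ih h5 _⟩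
    · rw [← h2]
      exact N.rep_eq_one b t j h
    · rwa [head_powMul]

theorem powMul_powMul {w : Word P} (hw : N.Normal w) (i j : ℕ) :
    N.powMul i (N.powMul j w) = N.powMul (i + j) w := by
  induction w generalizing i j with
  | base k => simp [powMul, add_assoc]
  | cons b t w ih =>
    obtain ⟨h1, h2, h3, h4, h5⟩ := hw
    have hm := mul_mem (N.pow_mem b j) h1
    simp only [powMul]
    rw [ih h5, N.rep_mul_rep _ hm, N.exp_mul_rep _ hm, ← mul_assoc, ← pow_add]

theorem powMul_zero {w : Word P} (hw : N.Normal w) : N.powMul 0 w = w := by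
  induction w with
  | base k => simp [powMul]
  | cons b t w ih =>
    obtain ⟨h1, h2, h3, h4, h5⟩ := hw
    have he : N.exp b t = 0 := by rw [← h2, N.exp_rep h1]
    simp only [powMul, pow_zero, one_mul]
    rw [h2, he, ih h5]

/-- Left multiplication by a power of `h b` is injective on representatives of orbits. -/
theorem eq_of_rep_eq {b : Bool} {j : ℕ} {t s : P} (ht : t ∈ N.S b) (hs : s ∈ N.S b)
    (ht' : N.rep b t = t) (hs' : N.rep b s = s)
    (hr : N.rep b (N.h b ^ j * t) = N.rep b (N.h b ^ j * s)) : t = s := by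
  have key : ∀ {t s : P}, t ∈ N.S b → s ∈ N.S b → N.rep b t = t → N.rep b s = s →
      N.rep b (N.h b ^ j * t) = N.rep b (N.h b ^ j * s) →
      N.exp b (N.h b ^ j * t) ≤ N.exp b (N.h b ^ j * s) → t = s := by
    intro t s ht hs ht' hs' hr hle
    have h1 := N.rep_mul_pow b _ (mul_mem (N.pow_mem b j) ht)
    have h2 := N.rep_mul_pow b _ (mul_mem (N.pow_mem b j) hs)
    rw [← hr] at h2
    have h3 : N.h b ^ j * (t * N.h b ^ (N.exp b (N.h b ^ j * s) - N.exp b (N.h b ^ j * t))) =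
        N.h b ^ j * s := by
      rw [← mul_assoc]
      refine Eq.trans ?_ h2
      refine (congrArg (· * _) h1.symm).trans ?_
      rw [mul_assoc, ← pow_add, Nat.add_sub_cancel' hle]
    rw [← ht', ← hs', ← N.pow_left_cancel b _ _ _ h3, N.rep_mul]
  rcases le_total (N.exp b (N.h b ^ j * t)) (N.exp b (N.h b ^ j * s)) with hle | hle
  · exact key ht hs ht' hs' hr hle
  · exact (key hs ht hs' ht' hr.symm hle).symm

theorem powMul_injective {w w' : Word P} (hw : N.Normal w) (hw' : N.Normal w') {j : ℕ}
    (h : N.powMul j w = N.powMul j w') : w = w' := by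
  induction w generalizing w' j with
  | base k =>
    cases w' with
    | base k' => simpa [powMul] using h
    | cons b t w => simp [powMul] at h
  | cons b t w ih =>
    cases w' with
    | base k' => simp [powMul] at h
    | cons c s v =>
      simp only [powMul, Word.cons.injEq] at h
      obtain ⟨rfl, hr, hwv⟩ := h
      obtain rfl := N.eq_of_rep_eq hw.1 hw'.1 hw.2.1 hw'.2.1 hr
      rw [ih hw.2.2.2.2 hw'.2.2.2.2 hwv]

open Classical in
/-- Adjoin a letter on the left, unless it is trivial. -/
noncomputable def consNe (b : Bool) (t : P) (w : Word P) : Word P := if t = 1 then w else .cons b t w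

/-- The first letter if it is on side `b`, and `1` otherwise. -/
def letter (b : Bool) : Word P → P
  | .base _ => 1
  | .cons c t _ => if c = b then t else 1

/-- Left multiplication of a word by an element `a` of `S b`: the first letter on side `b`, possibly
trivial, is multiplied by `a`, and the power of `h b` that splits off is moved into the rest. -/
noncomputable def act (b : Bool) (a : P) (w : Word P) : Word P :=
  consNe b (N.rep b (a * letter b w)) (N.powMul (N.exp b (a * letter b w)) (rest b w))

theorem letter_of_head {b : Bool} {w : Word P} (hw : head w ≠ some b) : letter b w = 1 := by
  cases w with
  | base k => rfl
  | cons c t w => exact if_neg fun h => hw (congrArg some h)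

theorem letter_consNe {b : Bool} {t : P} {w : Word P} (hw : head w ≠ some b) :
    letter b (consNe b t w) = t := by
  unfold consNe
  split_ifs with h
  · rw [h, letter_of_head hw]
  · exact if_pos rfl

theorem rest_consNe {b : Bool} {t : P} {w : Word P} (hw : head w ≠ some b) :
    rest b (consNe b t w) = w := by
  unfold consNe
  split_ifs with h
  · exact rest_of_head hw
  · exact if_pos rfl

theorem consNe_letter_rest {b : Bool} {w : Word P} (hw : N.Normal w) :
    consNe b (letter b w) (rest b w) = w := by
  cases w with
  | base k => simp [consNe, letter, rest]
  | cons c t w =>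
    by_cases h : c = b
    · subst h
      simp [consNe, letter, rest, hw.2.2.1]
    · simp [consNe, letter, rest, h]

theorem letter_spec {b : Bool} {w : Word P} (hw : N.Normal w) :
    letter b w ∈ N.S b ∧ N.rep b (letter b w) = letter b w ∧ head (rest b w) ≠ some b ∧
      N.Normal (rest b w) := by
  cases w with
  | base k => exact ⟨one_mem _, N.rep_one b, nofun, trivial⟩
  | cons c t w =>
    by_cases h : c = b
    · subst h
      simpa [letter, rest] using ⟨hw.1, hw.2.1, hw.2.2.2.1, hw.2.2.2.2⟩
    · simpa [letter, rest, h, N.rep_one, head] using hw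

theorem normal_consNe {b : Bool} {t : P} {w : Word P} (ht : t ∈ N.S b) (ht' : N.rep b t = t)
    (hw : head w ≠ some b) (hw' : N.Normal w) : N.Normal (consNe b t w) := by
  unfold consNe
  split_ifs with h
  · exact hw'
  · exact ⟨ht, ht', h, hw, hw'⟩

theorem normal_act {b : Bool} {a : P} (ha : a ∈ N.S b) {w : Word P} (hw : N.Normal w) :
    N.Normal (N.act b a w) := by
  obtain ⟨h1, h2, h3, h4⟩ := N.letter_spec (b := b) hw
  exact N.normal_consNe (N.rep_mem b _ (mul_mem ha h1)) (N.rep_rep (mul_mem ha h1))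
    (by rwa [head_powMul]) (N.normal_powMul h4 _)

theorem letter_act {b : Bool} (a : P) {w : Word P} (hw : N.Normal w) :
    letter b (N.act b a w) = N.rep b (a * letter b w) :=
  letter_consNe (by rw [head_powMul]; exact (N.letter_spec hw).2.2.1)

theorem rest_act {b : Bool} (a : P) {w : Word P} (hw : N.Normal w) :
    rest b (N.act b a w) = N.powMul (N.exp b (a * letter b w)) (rest b w) :=
  rest_consNe (by rw [head_powMul]; exact (N.letter_spec hw).2.2.1)

theorem act_one {b : Bool} {w : Word P} (hw : N.Normal w) : N.act b 1 w = w := by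
  obtain ⟨h1, h2, h3, h4⟩ := N.letter_spec (b := b) hw
  have he : N.exp b (letter b w) = 0 := by rw [← h2, N.exp_rep h1]
  rw [act, one_mul, h2, he, N.powMul_zero h4, N.consNe_letter_rest hw]

theorem act_mul {b : Bool} (a : P) {a' : P} (ha' : a' ∈ N.S b) {w : Word P} (hw : N.Normal w) :
    N.act b (a * a') w = N.act b a (N.act b a' w) := by
  obtain ⟨h1, h2, h3, h4⟩ := N.letter_spec (b := b) hw
  have hm := mul_mem ha' h1
  conv_rhs => rw [act, N.letter_act _ hw, N.rest_act _ hw, N.powMul_powMul h4,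
    N.rep_mul_rep _ hm, N.exp_mul_rep _ hm]
  rw [act, mul_assoc]

/-- The powers of the amalgamated generator act in the same way from both sides. -/
theorem act_pow {b : Bool} (k : ℕ) {w : Word P} (hw : N.Normal w) :
    N.act b (N.h b ^ k) w = N.powMul k w := by
  by_cases hb : head w = some b
  · cases w with
    | base k => simp [head] at hb
    | cons c t w =>
      obtain rfl : c = b := by simpa [head] using hb
      have hne : N.rep c (N.h c ^ k * t) ≠ 1 := (N.normal_powMul hw k).2.2.1
      simp [act, letter, rest, consNe, hne, powMul]
  · rw [act, letter_of_head hb, rest_of_head hb, mul_one, N.rep_pow, N.exp_pow]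
    exact if_pos rfl

/-- The action of one side on normal words. -/
noncomputable def actHom (b : Bool) : N.S b →* Function.End {w : Word P // N.Normal w} where
  toFun a := fun w => ⟨N.act b a w, N.normal_act a.2 w.2⟩
  map_one' := funext fun w => Subtype.ext (N.act_one w.2)
  map_mul' a a' := funext fun w => Subtype.ext (N.act_mul a a'.2 w.2)

theorem actHom_h (b : Bool) (w : {w : Word P // N.Normal w}) :
    (N.actHom b ⟨N.h b, N.h_mem b⟩ w : Word P) = N.powMul 1 w := by
  have h1 := N.act_pow (b := b) 1 w.2
  rwa [pow_one] at h1

end Sides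

/-- The product of a word in a monoid that receives both sides; `h` is the image of the amalgamated
generator. -/
def Word.prod {P : Type u} [Monoid P] {M : Type v} [Monoid M] (f : Bool → P →* M) (h : M) :
    Word P → M
  | .base k => h ^ k
  | .cons b t w => f b t * w.prod f h

/-- A monoid `M` generated by the images of the two sides, with the images of `h true` and
`h false` equal, and which acts on normal words. -/
structure Sides.Realization {P : Type u} [Monoid P] (N : Sides P) (M : Type v) [Monoid M] where
  f : Bool → P →* M
  h : M
  ρ : M →* Function.End {w : Word P // N.Normal w}
  f_h : ∀ b, f b (N.h b) = h
  generate : Submonoid.closure (⋃ b, ((N.S b).map (f b) : Set M)) = ⊤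
  ρ_f : ∀ b, ∀ a (ha : a ∈ N.S b), ρ (f b a) = N.actHom b ⟨a, ha⟩

namespace Sides.Realization

variable {P : Type u} [Monoid P] {N : Sides P} {M : Type v} [Monoid M] (R : N.Realization M)

theorem prod_powMul {w : Word P} (hw : N.Normal w) (j : ℕ) :
    (N.powMul j w).prod R.f R.h = R.h ^ j * w.prod R.f R.h := by
  induction w generalizing j with
  | base k => simp [powMul, Word.prod, pow_add]
  | cons b t w ih =>
    have h1 := N.rep_mul_pow b _ (mul_mem (N.pow_mem b j) hw.1)
    simp only [powMul, Word.prod]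
    rw [ih hw.2.2.2.2, ← R.f_h b, ← map_pow, ← map_pow, ← mul_assoc, ← map_mul, h1, map_mul,
      mul_assoc]

theorem prod_consNe (b : Bool) (t : P) (w : Word P) :
    (consNe b t w).prod R.f R.h = R.f b t * w.prod R.f R.h := by
  unfold consNe
  split_ifs with h
  · rw [h, map_one, one_mul]
  · rfl

theorem prod_act {b : Bool} {a : P} (ha : a ∈ N.S b) {w : Word P} (hw : N.Normal w) :
    (N.act b a w).prod R.f R.h = R.f b a * w.prod R.f R.h := by
  obtain ⟨h1, h2, h3, h4⟩ := N.letter_spec (b := b) hw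
  conv_rhs => rw [← N.consNe_letter_rest (b := b) hw]
  rw [act, R.prod_consNe, R.prod_powMul h4, R.prod_consNe, ← R.f_h b, ← map_pow, ← mul_assoc,
    ← mul_assoc, ← map_mul, ← map_mul, N.rep_mul_pow b _ (mul_mem ha h1)]

/-- The normal word of an element. -/
def word (x : M) : {w : Word P // N.Normal w} := R.ρ x ⟨.base 0, trivial⟩

theorem word_mul {b : Bool} {a : P} (ha : a ∈ N.S b) (x : M) :
    (R.word (R.f b a * x) : Word P) = N.act b a (R.word x) := by
  rw [word, map_mul, R.ρ_f b a ha]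
  rfl

theorem word_pow_mul (k : ℕ) (x : M) :
    (R.word (R.h ^ k * x) : Word P) = N.powMul k (R.word x) := by
  rw [← R.f_h true, ← map_pow, R.word_mul (N.pow_mem _ k), N.act_pow _ (R.word x).2]

theorem word_one : (R.word 1 : Word P) = .base 0 := by rw [word, map_one]; rfl

theorem word_pow (k : ℕ) : (R.word (R.h ^ k) : Word P) = .base k := by
  rw [← mul_one (R.h ^ k), R.word_pow_mul, word_one]
  rfl

theorem prod_word (x : M) : (R.word x : Word P).prod R.f R.h = x := by
  have hx : x ∈ Submonoid.closure (⋃ b, ((N.S b).map (R.f b) : Set M)) :=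
    R.generate ▸ Submonoid.mem_top x
  induction hx using Submonoid.closure_induction_left with
  | one => rw [word_one]; exact pow_zero _
  | mul_left s hs y _ ih =>
    obtain ⟨b, a, ha, rfl⟩ := Set.mem_iUnion.1 hs
    rw [R.word_mul ha, R.prod_act ha (R.word y).2, ih]

theorem word_injective {x y : M} (h : (R.word x : Word P) = R.word y) : x = y := by
  rw [← R.prod_word x, h, R.prod_word]

theorem h_left_cancel {x y : M} (hxy : R.h * x = R.h * y) : x = y := by
  refine R.word_injective (N.powMul_injective (R.word x).2 (R.word y).2 (j := 1) ?_)
  rw [← R.word_pow_mul, ← R.word_pow_mul, pow_one, hxy]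

/-- Both sides embed. -/
theorem f_injective {b : Bool} {a a' : P} (ha : a ∈ N.S b) (ha' : a' ∈ N.S b)
    (h : R.f b a = R.f b a') : a = a' := by
  have hw : N.act b a (.base 0) = N.act b a' (.base 0) := by
    rw [← R.word_one, ← R.word_mul ha, ← R.word_mul ha', h]
  have hn : N.Normal (.base 0) := trivial
  have h1 := congrArg (letter b) hw
  have h2 := congrArg (rest b) hw
  rw [N.letter_act _ hn, N.letter_act _ hn] at h1
  rw [N.rest_act _ hn, N.rest_act _ hn] at h2
  simp only [letter, rest, mul_one, powMul, add_zero, Word.base.injEq] at h1 h2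
  rw [← N.rep_mul_pow b a ha, h1, h2, N.rep_mul_pow b a' ha']

/-- A product that starts on one side has a normal word that starts there. -/
theorem head_word {b : Bool} {y : M}
    (hy : StartsOn (fun b => (N.S b).map (R.f b)) R.h (!b) y) :
    head (R.word y : Word P) ≠ some b := by
  generalize hc : (!b) = c at hy
  induction hy generalizing b with
  | pow c k => rw [R.word_pow]; exact nofun
  | @mul c t y ht hn hy ih =>
    obtain ⟨a, ha, rfl⟩ := ht
    have h1 := ih (b := c) rfl
    have h2 : N.rep c a ≠ 1 := by
      intro h
      refine hn ⟨N.exp c a, ?_⟩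
      change R.h ^ N.exp c a = _
      rw [← R.f_h c, ← map_pow, ← N.rep_mul_pow c a ha, h, one_mul, ← one_mul (N.h c ^ N.exp c a),
        N.exp_mul, N.exp_one, zero_add, one_mul]
    rw [R.word_mul ha, act, letter_of_head h1, mul_one, consNe, if_neg h2, head, ← hc]
    cases b <;> simp

/-- Two factorizations of the same element, into an element of one side and a product that starts on
the other side, differ by moving powers of `h` across. -/
theorem amalgam (b : Bool) {s t : M} (hs : s ∈ (N.S b).map (R.f b)) (ht : t ∈ (N.S b).map (R.f b))
    {y z : M} (hy : StartsOn (fun b => (N.S b).map (R.f b)) R.h (!b) y)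
    (hz : StartsOn (fun b => (N.S b).map (R.f b)) R.h (!b) z) (h : s * y = t * z) :
    ∃ r ∈ (N.S b).map (R.f b), ∃ i j : ℕ,
      s = r * R.h ^ i ∧ t = r * R.h ^ j ∧ R.h ^ i * y = R.h ^ j * z := by
  obtain ⟨a, ha, rfl⟩ := hs
  obtain ⟨a', ha', rfl⟩ := ht
  have hw : N.act b a (R.word y) = N.act b a' (R.word z) := by
    rw [← R.word_mul ha, ← R.word_mul ha', h]
  have h1 := congrArg (letter b) hw
  have h2 := congrArg (rest b) hw
  rw [N.letter_act _ (R.word y).2, N.letter_act _ (R.word z).2, letter_of_head (R.head_word hy),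
    letter_of_head (R.head_word hz), mul_one, mul_one] at h1
  rw [N.rest_act _ (R.word y).2, N.rest_act _ (R.word z).2, letter_of_head (R.head_word hy),
    letter_of_head (R.head_word hz), mul_one, mul_one, rest_of_head (R.head_word hy),
    rest_of_head (R.head_word hz)] at h2
  refine ⟨R.f b (N.rep b a), ⟨_, N.rep_mem b a ha, rfl⟩, N.exp b a, N.exp b a', ?_, ?_, ?_⟩
  · rw [← R.f_h b, ← map_pow, ← map_mul, N.rep_mul_pow b a ha]
  · rw [h1, ← R.f_h b, ← map_pow, ← map_mul, N.rep_mul_pow b a' ha']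
  · apply R.word_injective
    rw [R.word_pow_mul, R.word_pow_mul, h2]

end Sides.Realization
end Words

/-! ### Quasi-central elements -/

section QuasiCentral

variable {M : Type u} [Monoid M]

/-- Every element can be moved across `Δ`, in either direction, at the price of being replaced by
another element. -/
def QuasiCentral (Δ : M) : Prop :=
  (∀ a, ∃ b, a * Δ = Δ * b) ∧ ∀ a, ∃ b, Δ * a = b * Δ

theorem QuasiCentral.of_closure {Δ : M} {s : Set M} (hs : Submonoid.closure s = ⊤)
    (h₁ : ∀ a ∈ s, ∃ b, a * Δ = Δ * b) (h₂ : ∀ a ∈ s, ∃ b, Δ * a = b * Δ) : QuasiCentral Δ := by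
  constructor
  · intro a
    have ha : a ∈ Submonoid.closure s := hs ▸ Submonoid.mem_top a
    induction ha using Submonoid.closure_induction with
    | mem x hx => exact h₁ x hx
    | one => exact ⟨1, by simp⟩
    | mul x y _ _ hx hy =>
      obtain ⟨x', hx'⟩ := hx
      obtain ⟨y', hy'⟩ := hy
      exact ⟨x' * y', by rw [mul_assoc, hy', ← mul_assoc, hx', mul_assoc]⟩
  · intro a
    have ha : a ∈ Submonoid.closure s := hs ▸ Submonoid.mem_top a
    induction ha using Submonoid.closure_induction with
    | mem x hx => exact h₂ x hx
    | one => exact ⟨1, by simp⟩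
    | mul x y _ _ hx hy =>
      obtain ⟨x', hx'⟩ := hx
      obtain ⟨y', hy'⟩ := hy
      exact ⟨x' * y', by rw [← mul_assoc, hx', mul_assoc, hy', mul_assoc]⟩

theorem QuasiCentral.pow {Δ : M} (h : QuasiCentral Δ) (k : ℕ) : QuasiCentral (Δ ^ k) := by
  induction k with
  | zero => exact ⟨fun a => ⟨a, by simp⟩, fun a => ⟨a, by simp⟩⟩
  | succ k ih =>
    constructor
    · intro a
      obtain ⟨b, hb⟩ := ih.1 a
      obtain ⟨c, hc⟩ := h.1 b
      exact ⟨c, by rw [pow_succ, ← mul_assoc, hb, mul_assoc, hc, mul_assoc]⟩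
    · intro a
      obtain ⟨b, hb⟩ := h.2 a
      obtain ⟨c, hc⟩ := ih.2 b
      exact ⟨c, by rw [pow_succ, mul_assoc, hb, ← mul_assoc, hc, mul_assoc]⟩

theorem IsGarsideElement.quasiCentral {Δ : M} (h : IsGarsideElement Δ) : QuasiCentral Δ := by
  have hl {a : M} (ha : a ∣ Δ) : a ∣ᵣ Δ := (Set.ext_iff.1 h.divisors_coincide a).1 ha
  have hr {a : M} (ha : a ∣ᵣ Δ) : a ∣ Δ := (Set.ext_iff.1 h.divisors_coincide a).2 ha
  refine .of_closure h.divisors_generate ?_ ?_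
  · rintro a ⟨b, hb⟩
    obtain ⟨c, hc⟩ := hr ⟨a, hb⟩
    exact ⟨c, by rw [hc, ← mul_assoc, ← hb, ← hc]⟩
  · intro a ha
    obtain ⟨d, hd⟩ := hl ha
    obtain ⟨e, he⟩ := hl ⟨a, hd⟩
    exact ⟨e, by
      calc Δ * a = e * (d * a) := by rw [← mul_assoc, ← he]
        _ = e * Δ := by rw [← hd]⟩

theorem QuasiCentral.isGarsideElement [IsCancelMul M] {Δ : M} (h : QuasiCentral Δ)
    (hgen : Submonoid.closure {a : M | a ∣ Δ} = ⊤) : IsGarsideElement Δ := by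
  refine ⟨Set.ext fun a => ⟨?_, ?_⟩, hgen⟩
  · rintro ⟨b, hb⟩
    obtain ⟨d, hd⟩ := h.2 b
    exact ⟨d, mul_right_cancel (b := b) (by rw [mul_assoc, ← hb, hd])⟩
  · rintro ⟨d, hd⟩
    obtain ⟨b, hb⟩ := h.1 d
    exact ⟨b, mul_left_cancel (a := d) (by rw [← mul_assoc, ← hd, hb])⟩

theorem IsGarsideElement.exists_dvd_pow {Δ : M} (h : IsGarsideElement Δ) (a : M) :
    ∃ k, a ∣ Δ ^ k := by
  have ha : a ∈ Submonoid.closure {a : M | a ∣ Δ} := h.divisors_generate ▸ Submonoid.mem_top a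
  induction ha using Submonoid.closure_induction with
  | mem x hx => exact ⟨1, by simpa using hx⟩
  | one => exact ⟨0, one_dvd _⟩
  | mul x y _ _ hx hy =>
    obtain ⟨k, x', hx'⟩ := hx
    obtain ⟨l, y', hy'⟩ := hy
    obtain ⟨z, hz⟩ := (h.quasiCentral.pow l).1 x'
    exact ⟨k + l, y' * z, by
      rw [pow_add, hx', mul_assoc x x', hz, hy']; simp only [mul_assoc]⟩

theorem IsGarsideElement.exists_rightDvd_pow {Δ : M} (h : IsGarsideElement Δ) (a : M) :
    ∃ k, a ∣ᵣ Δ ^ k := by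
  have ha : a ∈ Submonoid.closure {a : M | a ∣ Δ} := h.divisors_generate ▸ Submonoid.mem_top a
  induction ha using Submonoid.closure_induction with
  | mem x hx =>
    obtain ⟨d, hd⟩ := (Set.ext_iff.1 h.divisors_coincide x).1 hx
    exact ⟨1, d, by rw [pow_one, hd]⟩
  | one => exact ⟨0, 1, by simp⟩
  | mul x y _ _ hx hy =>
    obtain ⟨k, x', hx'⟩ := hx
    obtain ⟨l, y', hy'⟩ := hy
    obtain ⟨z, hz⟩ := (h.quasiCentral.pow k).2 y'
    exact ⟨k + l, z * x', by
      rw [pow_add, hy', ← mul_assoc, hz, hx']; simp only [mul_assoc]⟩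

end QuasiCentral

/-! ### The two factors -/

section Factor

variable {M : Type u} [Monoid M]

/-- The properties of a factor of a cyclic amalgam along `h` from which the lcms of the amalgam are
obtained. They are invariant under passing to the opposite monoid. -/
structure IsFactor (h : M) : Prop where
  conical : ∀ x y : M, x * y = 1 → x = 1
  cancel : IsCancelMul M
  exists_rightLcm : ∀ a b : M, ∃ c, IsRightLcm a b c
  exists_leftLcm : ∀ a b : M, ∃ c, IsLeftLcm a b c
  ne_one : h ≠ 1
  exists_dvd_pow : ∀ a : M, ∃ k, a ∣ h ^ k
  exists_rightDvd_pow : ∀ a : M, ∃ k, a ∣ᵣ h ^ k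

theorem op_dvd_op {a b : M} : op a ∣ op b ↔ a ∣ᵣ b :=
  ⟨fun ⟨c, hc⟩ => ⟨c.unop, op_injective hc⟩, fun ⟨c, hc⟩ => ⟨op c, congrArg op hc⟩⟩

theorem op_rightDvd_op {a b : M} : op a ∣ᵣ op b ↔ a ∣ b :=
  ⟨fun ⟨c, hc⟩ => ⟨c.unop, op_injective hc⟩, fun ⟨c, hc⟩ => ⟨op c, congrArg op hc⟩⟩

theorem isRightLcm_op {a b c : M} : IsRightLcm (op a) (op b) (op c) ↔ IsLeftLcm a b c := by
  simp only [IsRightLcm, IsLeftLcm, op_dvd_op, MulOpposite.forall]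

theorem isLeftLcm_op {a b c : M} : IsLeftLcm (op a) (op b) (op c) ↔ IsRightLcm a b c := by
  simp only [IsRightLcm, IsLeftLcm, op_rightDvd_op, MulOpposite.forall]

theorem mul_eq_one_of_conical {h : M} (F : IsFactor h) {x y : M} (hxy : x * y = 1) : y = 1 := by
  rwa [F.conical x y hxy, one_mul] at hxy

theorem IsFactor.op {h : M} (F : IsFactor h) : IsFactor (op h) where
  conical _ _ hxy := unop_injective (mul_eq_one_of_conical F (op_injective hxy))
  cancel := have := F.cancel; inferInstance
  exists_rightLcm a b := (F.exists_leftLcm a.unop b.unop).imp' MulOpposite.op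
    fun _ => isRightLcm_op.2
  exists_leftLcm a b := (F.exists_rightLcm a.unop b.unop).imp' MulOpposite.op
    fun _ => isLeftLcm_op.2
  ne_one h1 := F.ne_one (op_injective h1)
  exists_dvd_pow a := (F.exists_rightDvd_pow a.unop).imp fun _ => op_dvd_op.2
  exists_rightDvd_pow a := (F.exists_dvd_pow a.unop).imp fun _ => op_rightDvd_op.2

theorem IsGarsideMonoid.isFactor (hM : IsGarsideMonoid M) {h : M} (root : IsRootOfGarsideElement h)
    (ne : h ≠ 1) : IsFactor h := by
  have := hM.cancellative
  obtain ⟨q, -, hq⟩ := root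
  refine ⟨fun x y hxy => hM.conical x ?_, hM.cancellative, hM.exists_rightLcm, hM.exists_leftLcm,
    ne, fun a => ?_, fun a => ?_⟩
  · refine ⟨⟨x, y, hxy, ?_⟩, rfl⟩
    exact mul_left_cancel (a := x) (by rw [← mul_assoc, hxy, one_mul, mul_one])
  · obtain ⟨k, hk⟩ := hq.exists_dvd_pow a
    exact ⟨q * k, by rwa [pow_mul]⟩
  · obtain ⟨k, hk⟩ := hq.exists_rightDvd_pow a
    exact ⟨q * k, by rwa [pow_mul]⟩

/-- A choice of orbit representatives for the right multiplication by powers of `h`. -/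
structure Representatives (h : M) where
  rep : M → M
  exp : M → ℕ
  rep_mul_pow : ∀ a, rep a * h ^ exp a = a
  rep_mul : ∀ a k, rep (a * h ^ k) = rep a
  exp_mul : ∀ a k, exp (a * h ^ k) = exp a + k
  rep_one : rep 1 = 1
  rep_eq_one : ∀ a k, rep (h ^ k * a) = 1 → rep a = 1

/-- The representative of an orbit is its element that `h` does not divide on the right. -/
theorem IsFactor.nonempty_representatives {h : M} (F : IsFactor h) :
    Nonempty (Representatives h) := by
  have := F.cancel
  have ex (a : M) : ∃ t, ∃ e : ℕ, t * h ^ e = a ∧ ¬ h ∣ᵣ t := by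
    by_contra hcon
    push Not at hcon
    -- otherwise all powers of `h` divide `a` on the right, and hence a fixed power of `h`
    have hall : ∀ e : ℕ, ∃ t, t * h ^ e = a := by
      intro e
      induction e with
      | zero => exact ⟨a, by simp⟩
      | succ e ih =>
        obtain ⟨t, ht⟩ := ih
        obtain ⟨s, rfl⟩ := hcon t e ht
        exact ⟨s, by rw [pow_succ', ← mul_assoc, ht]⟩
    obtain ⟨k, d, hd⟩ := F.exists_rightDvd_pow a
    obtain ⟨t, rfl⟩ := hall (k + 1)
    have h1 : 1 = d * t * h := by
      refine mul_right_cancel (b := h ^ k) ?_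
      rw [one_mul, mul_assoc, ← pow_succ', mul_assoc]
      exact hd
    exact F.ne_one (mul_eq_one_of_conical F h1.symm)
  have uniq {t s : M} {e f : ℕ} (hts : t * h ^ e = s * h ^ f) (ht : ¬ h ∣ᵣ t) (hs : ¬ h ∣ᵣ s) :
      t = s ∧ e = f := by
    have key {t s : M} {e f : ℕ} (hts : t * h ^ e = s * h ^ f) (ht : ¬ h ∣ᵣ t) (hle : e ≤ f) :
        t = s ∧ e = f := by
      obtain ⟨d, rfl⟩ := Nat.exists_eq_add_of_le hle
      have h1 : t = s * h ^ d := by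
        refine mul_right_cancel (b := h ^ e) ?_
        rw [hts, mul_assoc, ← pow_add, add_comm]
      rcases d with _ | d
      · simpa using h1
      · exact absurd ⟨s * h ^ d, by rw [h1, pow_succ, mul_assoc]⟩ ht
    rcases le_total e f with hle | hle
    · exact key hts ht hle
    · exact (key hts.symm hs hle).imp Eq.symm Eq.symm
  choose rep exp hrep hred using ex
  have hmul (a : M) (k : ℕ) : rep (a * h ^ k) = rep a ∧ exp (a * h ^ k) = exp a + k :=
    uniq (by rw [hrep, pow_add, ← mul_assoc, hrep]) (hred _) (hred _)
  have hone : rep 1 = 1 := F.conical _ _ (hrep 1)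
  have hpow (k : ℕ) : rep (h ^ k) = 1 := by simpa [hone] using (hmul 1 k).1
  refine ⟨⟨rep, exp, hrep, fun a k => (hmul a k).1, fun a k => (hmul a k).2, hone, ?_⟩⟩
  intro a k hk
  have h1 := hrep (h ^ k * a)
  rw [hk, one_mul] at h1
  rcases le_total k (exp (h ^ k * a)) with hle | hle
  · have h2 : a = h ^ (exp (h ^ k * a) - k) := by
      refine mul_left_cancel (a := h ^ k) ?_
      rw [← pow_add, Nat.add_sub_cancel' hle, h1]
    rw [h2, hpow]
  · have h2 : h ^ (k - exp (h ^ k * a)) * a = 1 := by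
      refine mul_left_cancel (a := h ^ exp (h ^ k * a)) ?_
      rw [← mul_assoc, ← pow_add, Nat.add_sub_cancel' hle, mul_one, h1]
    rw [mul_eq_one_of_conical F h2, hone]

/-- In a Garside monoid with a Garside element that has finitely many divisors, all elements have
finitely many divisors. -/
theorem IsGarsideMonoid.finite_dvd (hM : IsGarsideMonoid M) (hfin : HasFiniteGarsideElement M)
    (a : M) : {d : M | d ∣ a}.Finite := by
  have := hM.cancellative
  obtain ⟨Δ, hΔ, hΔf⟩ := hfin
  obtain ⟨k, hk⟩ := hΔ.exists_dvd_pow a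
  suffices h : {d : M | d ∣ Δ ^ k}.Finite from h.subset fun d hd => dvd_trans hd hk
  clear hk
  induction k with
  | zero => 
    refine (Set.finite_singleton 1).subset ?_
    rintro d ⟨e, he⟩
    rw [pow_zero] at he
    refine hM.conical d ⟨⟨d, e, he.symm, ?_⟩, rfl⟩
    exact mul_left_cancel (a := d) (by rw [← mul_assoc, ← he, one_mul, mul_one])
  | succ k ih =>
    -- the lcm of a divisor `d` of `Δ ^ (k + 1)` and `Δ ^ k` has the form `d * e = Δ ^ k * c` with
    -- `e ∣ Δ ^ k` and `c ∣ Δ`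
    have hsub : {d : M | d ∣ Δ ^ (k + 1)} ⊆
        ⋃ e ∈ {e : M | e ∣ Δ ^ k}, ⋃ c ∈ {c : M | c ∣ Δ}, {d : M | d * e = Δ ^ k * c} := by
      intro d hd
      obtain ⟨m, ⟨e, he⟩, ⟨c, hc⟩, hm⟩ := hM.exists_rightLcm d (Δ ^ k)
      simp only [Set.mem_iUnion]
      refine ⟨e, ?_, c, ?_, he.symm.trans hc⟩
      · obtain ⟨b, hb⟩ := (hΔ.quasiCentral.pow k).1 d
        obtain ⟨x, hx⟩ := hm (d * Δ ^ k) (dvd_mul_right _ _) ⟨b, hb⟩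
        exact ⟨x, mul_left_cancel (a := d) (by rw [hx, he, mul_assoc])⟩
      · obtain ⟨x, hx⟩ := hm (Δ ^ (k + 1)) hd ⟨Δ, pow_succ _ _⟩
        exact ⟨x, mul_left_cancel (a := Δ ^ k) (by rw [← pow_succ, hx, hc, mul_assoc])⟩
    refine (ih.biUnion fun e _ => hΔf.biUnion fun c _ => Set.Subsingleton.finite ?_).subset hsub
    intro x hx y hy
    exact mul_right_cancel (b := e) (hx.trans hy.symm)

end Factor

/-! ### Cyclic amalgams -/

section Amalgam

variable {M₁ : Type u} {M₂ : Type v} {M : Type w} [Monoid M₁] [Monoid M₂] [Monoid M]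

/-- `M` is the amalgam of `M₁` and `M₂` with `h₁` and `h₂` identified; the universal property is
that of a pushout, with generation in the place of the uniqueness of the induced morphisms. This
form is invariant under passing to the opposite monoids. -/
structure IsAmalgam (f₁ : M₁ →* M) (f₂ : M₂ →* M) (h₁ : M₁) (h₂ : M₂) : Prop where
  comm : f₁ h₁ = f₂ h₂
  generate : Submonoid.closure (Set.range f₁ ∪ Set.range f₂) = ⊤
  exists_lift : ∀ (E : Type (max u v)) [Monoid E] (g₁ : M₁ →* E) (g₂ : M₂ →* E), g₁ h₁ = g₂ h₂ →
    ∃ g : M →* E, (∀ a, g (f₁ a) = g₁ a) ∧ ∀ a, g (f₂ a) = g₂ a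

variable {f₁ : M₁ →* M} {f₂ : M₂ →* M} {h₁ : M₁} {h₂ : M₂}

theorem IsAmalgam.induction (A : IsAmalgam f₁ f₂ h₁ h₂) {p : M → Prop} (one : p 1)
    (left : ∀ a x, p x → p (f₁ a * x)) (right : ∀ a x, p x → p (f₂ a * x)) (x : M) : p x := by
  have hx : x ∈ Submonoid.closure (Set.range f₁ ∪ Set.range f₂) :=
    A.generate ▸ Submonoid.mem_top x
  induction hx using Submonoid.closure_induction_left with
  | one => exact one
  | mul_left s hs y _ ih =>
    rcases hs with ⟨a, rfl⟩ | ⟨a, rfl⟩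
    · exact left a y ih
    · exact right a y ih

theorem IsAmalgam.op (A : IsAmalgam f₁ f₂ h₁ h₂) :
    IsAmalgam (MonoidHom.op f₁) (MonoidHom.op f₂) (op h₁) (op h₂) where
  comm := congrArg MulOpposite.op A.comm
  generate := by
    rw [eq_top_iff]
    intro x _
    rw [← op_unop x]
    induction x.unop using A.induction with
    | one => exact one_mem _
    | left a y ih => exact mul_mem ih (Submonoid.subset_closure (.inl ⟨MulOpposite.op a, rfl⟩))
    | right a y ih => exact mul_mem ih (Submonoid.subset_closure (.inr ⟨MulOpposite.op a, rfl⟩))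
  exists_lift E _ g₁ g₂ hg := by
    obtain ⟨g, hg₁, hg₂⟩ := A.exists_lift Eᵐᵒᵖ
      { toFun := fun a => MulOpposite.op (g₁ (MulOpposite.op a))
        map_one' := by simp
        map_mul' := by simp }
      { toFun := fun a => MulOpposite.op (g₂ (MulOpposite.op a))
        map_one' := by simp
        map_mul' := by simp }
      (congrArg MulOpposite.op hg)
    exact ⟨{ toFun := fun x => (g x.unop).unop
             map_one' := by simp
             map_mul' := by simp },
      fun a => congrArg unop (hg₁ a.unop), fun a => congrArg unop (hg₂ a.unop)⟩

theorem IsFactor.exists_indicator {h : M} (F : IsFactor h) :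
    ∃ g : M →* ℕ, g h = 0 ∧ ∀ a, g a = 1 → a = 1 := by
  classical
  refine ⟨{ toFun := fun a => if a = 1 then 1 else 0
            map_one' := if_pos rfl
            map_mul' := fun a b => ?_ }, if_neg F.ne_one, fun a ha => ?_⟩
  · by_cases hab : a * b = 1
    · simp [F.conical a b hab, mul_eq_one_of_conical F hab]
    · by_cases ha : a = 1
      · simp [ha]
      · simp [hab, ha]
  · by_contra h1
    simp [h1] at ha

/-- The indicators of the identity of the two factors extend to a morphism on the amalgam, which
takes the value `1` only at the identity. -/
theorem IsAmalgam.conical (A : IsAmalgam f₁ f₂ h₁ h₂) (F₁ : IsFactor h₁) (F₂ : IsFactor h₂)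
    {x y : M} (hxy : x * y = 1) : x = 1 := by
  obtain ⟨g₁, hg₁, hg₁'⟩ := F₁.exists_indicator
  obtain ⟨g₂, hg₂, hg₂'⟩ := F₂.exists_indicator
  obtain ⟨g, hg, hg'⟩ := A.exists_lift (ULift ℕ) (MulEquiv.ulift.symm.toMonoidHom.comp g₁)
    (MulEquiv.ulift.symm.toMonoidHom.comp g₂) (by simp [hg₁, hg₂])
  have hd₁ (a : M₁) : (g (f₁ a)).down = g₁ a := congrArg ULift.down (hg a)
  have hd₂ (a : M₂) : (g (f₂ a)).down = g₂ a := congrArg ULift.down (hg' a)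
  have key (z : M) : (g z).down = 1 → z = 1 := by
    induction z using A.induction with
    | one => exact fun _ => rfl
    | left a z ih =>
      intro hz
      rw [map_mul, ULift.mul_down, hd₁, mul_eq_one] at hz
      rw [hg₁' a hz.1, ih hz.2, map_one, mul_one]
    | right a z ih =>
      intro hz
      rw [map_mul, ULift.mul_down, hd₂, mul_eq_one] at hz
      rw [hg₂' a hz.1, ih hz.2, map_one, mul_one]
  have h1 := congrArg (fun z => (g z).down) hxy
  simp only [map_mul, ULift.mul_down, map_one, ULift.one_down, mul_eq_one] at h1
  exact key x h1.1

/-- The two factors as submonoids of their product, which puts their elements into one type. On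
side `true`, the second coordinate is ignored and set to `1`; symmetrically on side `false`. -/
def Sides.ofPair (A₁ : Representatives h₁) (A₂ : Representatives h₂)
    (c₁ : IsCancelMul M₁) (c₂ : IsCancelMul M₂) : Sides (M₁ × M₂) where
  S
    | true => MonoidHom.mrange (MonoidHom.inl M₁ M₂)
    | false => MonoidHom.mrange (MonoidHom.inr M₁ M₂)
  h
    | true => (h₁, 1)
    | false => (1, h₂)
  rep
    | true, a => (A₁.rep a.1, 1)
    | false, a => (1, A₂.rep a.2)
  exp
    | true, a => A₁.exp a.1
    | false, a => A₂.exp a.2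
  h_mem
    | true => ⟨h₁, rfl⟩
    | false => ⟨h₂, rfl⟩
  rep_mem
    | true, a, _ => ⟨A₁.rep a.1, rfl⟩
    | false, a, _ => ⟨A₂.rep a.2, rfl⟩
  rep_mul_pow
    | true, _, ⟨a, rfl⟩ => by simp [A₁.rep_mul_pow]
    | false, _, ⟨a, rfl⟩ => by simp [A₂.rep_mul_pow]
  rep_mul
    | true, a, k => by simp [A₁.rep_mul]
    | false, a, k => by simp [A₂.rep_mul]
  exp_mul
    | true, a, k => by simp [A₁.exp_mul]
    | false, a, k => by simp [A₂.exp_mul]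
  rep_one
    | true => by simp [A₁.rep_one]
    | false => by simp [A₂.rep_one]
  rep_eq_one
    | true, a, k, h => by simpa using A₁.rep_eq_one a.1 k (by simpa using h)
    | false, a, k, h => by simpa using A₂.rep_eq_one a.2 k (by simpa using h)
  pow_left_cancel
    | true, k, a, a', h => mul_left_cancel h
    | false, k, a, a', h => mul_left_cancel h

/-- By the universal property, the two actions on normal words, which agree on `h₁` and `h₂`, extend
to the amalgam. -/
theorem IsAmalgam.exists_realization (A : IsAmalgam f₁ f₂ h₁ h₂) (A₁ : Representatives h₁)
    (A₂ : Representatives h₂) (c₁ : IsCancelMul M₁) (c₂ : IsCancelMul M₂) :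
    ∃ R : (Sides.ofPair A₁ A₂ c₁ c₂).Realization M, R.f true = f₁.comp (MonoidHom.fst M₁ M₂) ∧
      R.f false = f₂.comp (MonoidHom.snd M₁ M₂) ∧ R.h = f₁ h₁ := by
  set N := Sides.ofPair A₁ A₂ c₁ c₂
  obtain ⟨ρ, hρ₁, hρ₂⟩ := A.exists_lift (Function.End {w : Word (M₁ × M₂) // N.Normal w})
    ((N.actHom true).comp (MonoidHom.inl M₁ M₂).mrangeRestrict)
    ((N.actHom false).comp (MonoidHom.inr M₁ M₂).mrangeRestrict)
    (funext fun w => Subtype.ext ((N.actHom_h true w).trans (N.actHom_h false w).symm))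
  refine ⟨⟨fun b => match b with
    | true => f₁.comp (MonoidHom.fst M₁ M₂)
    | false => f₂.comp (MonoidHom.snd M₁ M₂), f₁ h₁, ρ, ?_, ?_, ?_⟩, rfl, rfl, rfl⟩
  · rintro (_ | _)
    · exact A.comm.symm
    · rfl
  · refine (Submonoid.eq_top_iff' _).2 fun x => ?_
    induction x using A.induction with
    | one => exact one_mem _
    | left a y ih =>
      exact mul_mem (Submonoid.subset_closure
        (Set.mem_iUnion.2 ⟨true, (a, 1), ⟨a, rfl⟩, rfl⟩)) ih
    | right a y ih =>
      exact mul_mem (Submonoid.subset_closure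
        (Set.mem_iUnion.2 ⟨false, (1, a), ⟨a, rfl⟩, rfl⟩)) ih
  · rintro (_ | _) _ ⟨a, rfl⟩
    · exact hρ₂ a
    · exact hρ₁ a

/-- An embedded factor satisfies the lcm condition of `IsDecomposition`. Divisibility is
understood inside the image, where it reflects divisibility in the factor. -/
theorem IsFactor.exists_lcm_map {N : Type u} [Monoid N] {h : N} (F : IsFactor h) {f : N →* M}
    (hf : Function.Injective f) {s t : M} (hs : s ∈ MonoidHom.mrange f)
    (ht : t ∈ MonoidHom.mrange f) :
    ∃ m ∈ MonoidHom.mrange f, (∃ d ∈ MonoidHom.mrange f, m = s * d) ∧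
      (∃ d ∈ MonoidHom.mrange f, m = t * d) ∧
        ∀ z, (∃ d ∈ MonoidHom.mrange f, z = s * d) → (∃ d ∈ MonoidHom.mrange f, z = t * d) →
          m ∣ z := by
  obtain ⟨a, rfl⟩ := hs
  obtain ⟨b, rfl⟩ := ht
  obtain ⟨c, ⟨d, hd⟩, ⟨e, he⟩, hc⟩ := F.exists_rightLcm a b
  refine ⟨f c, ⟨c, rfl⟩, ⟨f d, ⟨d, rfl⟩, by rw [hd, map_mul]⟩, ⟨f e, ⟨e, rfl⟩, by
    rw [he, map_mul]⟩, ?_⟩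
  rintro _ ⟨_, ⟨x, rfl⟩, rfl⟩ ⟨_, ⟨y, rfl⟩, hxy⟩
  rw [← map_mul, ← map_mul] at hxy
  rw [← map_mul]
  exact map_dvd f (hc _ (dvd_mul_right a x) (hf hxy ▸ dvd_mul_right b y))

theorem IsFactor.cofinal_map {N : Type u} [Monoid N] {h : N} (F : IsFactor h) (f : N →* M)
    {t : M} (ht : t ∈ MonoidHom.mrange f) : ∃ k : ℕ, ∃ d ∈ MonoidHom.mrange f, f h ^ k = t * d := by
  obtain ⟨a, rfl⟩ := ht
  obtain ⟨k, d, hd⟩ := F.exists_dvd_pow a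
  exact ⟨k, f d, ⟨d, rfl⟩, by rw [← map_pow, hd, map_mul]⟩

/-- The image of an element of a factor divides a power of `h` on the right, so it can be cancelled
on the left if `h` can. -/
theorem IsFactor.left_cancel_map {N : Type u} [Monoid N] {h : N} (F : IsFactor h) {f : N →* M}
    (hf : ∀ x y, f h * x = f h * y → x = y) (a : N) {x y : M} (hxy : f a * x = f a * y) :
    x = y := by
  obtain ⟨k, d, hd⟩ := F.exists_rightDvd_pow a
  have hk : f h ^ k * x = f h ^ k * y := by
    rw [← map_pow, hd, map_mul, mul_assoc, hxy, mul_assoc]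
  clear hd
  induction k with
  | zero => simpa using hk
  | succ k ih =>
    rw [pow_succ', mul_assoc, mul_assoc] at hk
    exact ih (hf _ _ hk)

/-- The images of the two factors in the amalgam. -/
def side (f₁ : M₁ →* M) (f₂ : M₂ →* M) : Bool → Submonoid M
  | true => MonoidHom.mrange f₁
  | false => MonoidHom.mrange f₂

theorem IsAmalgam.injective (A : IsAmalgam f₁ f₂ h₁ h₂) (F₁ : IsFactor h₁) (F₂ : IsFactor h₂) :
    Function.Injective f₁ ∧ Function.Injective f₂ := by
  obtain ⟨A₁⟩ := F₁.nonempty_representatives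
  obtain ⟨A₂⟩ := F₂.nonempty_representatives
  obtain ⟨R, hR₁, hR₂, -⟩ := A.exists_realization A₁ A₂ F₁.cancel F₂.cancel
  constructor
  · intro a b hab
    have h1 : R.f true (a, 1) = R.f true (b, 1) := by rw [hR₁]; exact hab
    exact congrArg Prod.fst (R.f_injective (b := true) ⟨a, rfl⟩ ⟨b, rfl⟩ h1)
  · intro a b hab
    have h1 : R.f false (1, a) = R.f false (1, b) := by rw [hR₂]; exact hab
    exact congrArg Prod.snd (R.f_injective (b := false) ⟨a, rfl⟩ ⟨b, rfl⟩ h1)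

/-- The amalgam is an internal amalgam of the images of its factors. -/
theorem IsAmalgam.isDecomposition (A : IsAmalgam f₁ f₂ h₁ h₂) (F₁ : IsFactor h₁)
    (F₂ : IsFactor h₂) : IsDecomposition (side f₁ f₂) (f₁ h₁) := by
  obtain ⟨A₁⟩ := F₁.nonempty_representatives
  obtain ⟨A₂⟩ := F₂.nonempty_representatives
  obtain ⟨R, hR₁, hR₂, hR⟩ := A.exists_realization A₁ A₂ F₁.cancel F₂.cancel
  let N := Sides.ofPair A₁ A₂ F₁.cancel F₂.cancel
  have hS : (fun b => (N.S b).map (R.f b)) = side f₁ f₂ := by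
    funext b
    rcases b with _ | _
    · change (MonoidHom.mrange (MonoidHom.inr M₁ M₂)).map (R.f false) = MonoidHom.mrange f₂
      rw [hR₂, MonoidHom.map_mrange]
      rfl
    · change (MonoidHom.mrange (MonoidHom.inl M₁ M₂)).map (R.f true) = MonoidHom.mrange f₁
      rw [hR₁, MonoidHom.map_mrange]
      rfl
  obtain ⟨inj₁, inj₂⟩ := A.injective F₁ F₂
  have hc : ∀ x y, f₁ h₁ * x = f₁ h₁ * y → x = y := by
    intro x y hxy
    exact R.h_left_cancel (by rwa [hR])
  have hc' : ∀ x y, f₂ h₂ * x = f₂ h₂ * y → x = y := by rwa [← A.comm]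
  refine
    { conical := fun x y hxy => A.conical F₁ F₂ hxy
      left_cancel := fun x => ?_
      base_mem := ?_
      base_ne := fun h => F₁.ne_one (inj₁ (by rw [h, map_one]))
      generate := ?_
      cofinal := ?_
      exists_lcm := ?_
      amalgam := ?_ }
  · induction x using A.induction with
    | one => intro y z hyz; simpa using hyz
    | left a x ih =>
      intro y z hyz
      rw [mul_assoc, mul_assoc] at hyz
      exact ih y z (F₁.left_cancel_map hc a hyz)
    | right a x ih =>
      intro y z hyz
      rw [mul_assoc, mul_assoc] at hyz
      exact ih y z (F₂.left_cancel_map hc' a hyz)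
  · rintro (_ | _)
    · exact ⟨h₂, A.comm.symm⟩
    · exact ⟨h₁, rfl⟩
  · rw [← hS]
    exact R.generate
  · rintro (_ | _) t ht
    · rw [A.comm]
      exact F₂.cofinal_map f₂ ht
    · exact F₁.cofinal_map f₁ ht
  · rintro (_ | _) s hs t ht
    · exact F₂.exists_lcm_map inj₂ hs ht
    · exact F₁.exists_lcm_map inj₁ hs ht
  · rw [← hS, ← hR]
    exact fun b s hs t ht y z hy hz h => R.amalgam b hs ht hy hz h

theorem IsAmalgam.quasiCentral (A : IsAmalgam f₁ f₂ h₁ h₂) {n : ℕ} (q₁ : QuasiCentral (h₁ ^ n))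
    (q₂ : QuasiCentral (h₂ ^ n)) : QuasiCentral (f₁ h₁ ^ n) := by
  have e₁ : f₁ h₁ ^ n = f₁ (h₁ ^ n) := (map_pow f₁ h₁ n).symm
  have e₂ : f₁ h₁ ^ n = f₂ (h₂ ^ n) := by rw [A.comm, map_pow]
  refine .of_closure A.generate ?_ ?_
  · rintro _ (⟨a, rfl⟩ | ⟨a, rfl⟩)
    · obtain ⟨b, hb⟩ := q₁.1 a
      exact ⟨f₁ b, by rw [e₁, ← map_mul, hb, map_mul]⟩
    · obtain ⟨b, hb⟩ := q₂.1 a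
      exact ⟨f₂ b, by rw [e₂, ← map_mul, hb, map_mul]⟩
  · rintro _ (⟨a, rfl⟩ | ⟨a, rfl⟩)
    · obtain ⟨b, hb⟩ := q₁.2 a
      exact ⟨f₁ b, by rw [e₁, ← map_mul, hb, map_mul]⟩
    · obtain ⟨b, hb⟩ := q₂.2 a
      exact ⟨f₂ b, by rw [e₂, ← map_mul, hb, map_mul]⟩

theorem IsAmalgam.closure_dvd_pow (A : IsAmalgam f₁ f₂ h₁ h₂) {n : ℕ}
    (c₁ : Submonoid.closure {a | a ∣ h₁ ^ n} = ⊤) (c₂ : Submonoid.closure {a | a ∣ h₂ ^ n} = ⊤) :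
    Submonoid.closure {x | x ∣ f₁ h₁ ^ n} = ⊤ := by
  rw [eq_top_iff, ← A.generate, Submonoid.closure_le]
  rintro _ (⟨a, rfl⟩ | ⟨a, rfl⟩)
  · have ha : a ∈ Submonoid.closure {a | a ∣ h₁ ^ n} := c₁ ▸ Submonoid.mem_top a
    have hle : Submonoid.closure {a | a ∣ h₁ ^ n} ≤
        (Submonoid.closure {x | x ∣ f₁ h₁ ^ n}).comap f₁ :=
      Submonoid.closure_le.2 fun d hd =>
        Submonoid.subset_closure (by rw [← map_pow]; exact map_dvd f₁ hd)
    exact hle ha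
  · have ha : a ∈ Submonoid.closure {a | a ∣ h₂ ^ n} := c₂ ▸ Submonoid.mem_top a
    have hle : Submonoid.closure {a | a ∣ h₂ ^ n} ≤
        (Submonoid.closure {x | x ∣ f₁ h₁ ^ n}).comap f₂ :=
      Submonoid.closure_le.2 fun d hd =>
        Submonoid.subset_closure (by rw [A.comm, ← map_pow]; exact map_dvd f₂ hd)
    exact hle ha

theorem IsGarsideElement.closure_dvd_pow_mul {N : Type u} [Monoid N] {h : N} {q m : ℕ}
    (hq : IsGarsideElement (h ^ q)) (hm : m ≠ 0) :
    Submonoid.closure {a | a ∣ h ^ (q * m)} = ⊤ := by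
  rw [eq_top_iff, ← hq.divisors_generate]
  refine Submonoid.closure_mono fun a ha => dvd_trans ha ?_
  rw [pow_mul]
  exact dvd_pow_self _ hm

/-- Finiteness of the set of divisors passes from a factor to its image. -/
theorem finite_setOf_dvd_map {N : Type u} [Monoid N] {h : N} {f : N →* M}
    (hinj : Function.Injective f) (hmem : ∀ {a : N} {x : M}, f a * x ∈ MonoidHom.mrange f →
      x ∈ MonoidHom.mrange f) (hfin : ∀ a : N, {d | d ∣ a}.Finite) (k : ℕ) :
    {t | t ∈ MonoidHom.mrange f ∧ t ∣ f h ^ k}.Finite := by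
  refine ((hfin (h ^ k)).image f).subset ?_
  rintro _ ⟨⟨a, rfl⟩, x, hx⟩
  obtain ⟨d, rfl⟩ := hmem (a := a) (x := x) ⟨h ^ k, by rw [map_pow, hx]⟩
  exact ⟨a, ⟨d, hinj (by rw [map_pow, hx, map_mul])⟩, rfl⟩

theorem cyclicAmalgam_isAmalgam (h₁ : M₁) (h₂ : M₂) :
    IsAmalgam ((amalgCon (powersHom M₁ h₁) (powersHom M₂ h₂)).mk'.comp Monoid.Coprod.inl)
      ((amalgCon (powersHom M₁ h₁) (powersHom M₂ h₂)).mk'.comp Monoid.Coprod.inr) h₁ h₂ where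
  comm := (Con.eq _).2 (ConGen.Rel.of _ _ ⟨Multiplicative.ofAdd 1, by simp, by simp⟩)
  generate := by
    rw [Submonoid.closure_union, ← MonoidHom.coe_mrange, ← MonoidHom.coe_mrange,
      Submonoid.closure_eq, Submonoid.closure_eq, ← MonoidHom.map_mrange, ← MonoidHom.map_mrange,
      ← Submonoid.map_sup, Monoid.Coprod.mrange_inl_sup_mrange_inr, ← MonoidHom.mrange_eq_map]
    exact MonoidHom.mrange_eq_top.2 Con.mk'_surjective
  exists_lift E _ g₁ g₂ hg := by
    refine ⟨Con.lift _ (Monoid.Coprod.lift g₁ g₂) (Con.conGen_le.2 ?_), fun a => ?_, fun a => ?_⟩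
    · rintro _ _ ⟨n, rfl, rfl⟩
      simp [Con.ker_rel, hg]
    · exact Monoid.Coprod.lift_apply_inl g₁ g₂ a
    · exact Monoid.Coprod.lift_apply_inr g₁ g₂ a

/-- The Garside element of the amalgam is a common power of `h₁` and `h₂` that is quasi-central on
both sides. -/
theorem IsAmalgam.isGarsideMonoid (A : IsAmalgam f₁ f₂ h₁ h₂)
    (F₁ : IsFactor h₁) (F₂ : IsFactor h₂) (r₁ : IsRootOfGarsideElement h₁)
    (r₂ : IsRootOfGarsideElement h₂) :
    IsGarsideMonoid M ∧ ∃ n, IsGarsideElement (f₁ h₁ ^ n) := by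
  have D := A.isDecomposition F₁ F₂
  have D' := A.op.isDecomposition F₁.op F₂.op
  have hcancel : IsCancelMul M :=
    { mul_left_cancel := fun x _ _ h => D.left_cancel x _ _ h
      mul_right_cancel := fun x _ _ h =>
        op_injective (D'.left_cancel (MulOpposite.op x) _ _ (congrArg MulOpposite.op h)) }
  obtain ⟨p, hp, hΔ₁⟩ := r₁
  obtain ⟨q, hq, hΔ₂⟩ := r₂
  have q₁ : QuasiCentral (h₁ ^ (p * q)) := by rw [pow_mul]; exact hΔ₁.quasiCentral.pow q
  have q₂ : QuasiCentral (h₂ ^ (p * q)) := by rw [pow_mul']; exact hΔ₂.quasiCentral.pow p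
  have hΔ : IsGarsideElement (f₁ h₁ ^ (p * q)) :=
    (A.quasiCentral q₁ q₂).isGarsideElement <| A.closure_dvd_pow (hΔ₁.closure_dvd_pow_mul hq.ne')
      (by rw [mul_comm]; exact hΔ₂.closure_dvd_pow_mul hp.ne')
  refine ⟨⟨?_, hcancel, fun a b => ?_, D.exists_isRightLcm, ⟨_, hΔ⟩⟩, _, hΔ⟩
  · rintro _ ⟨x, rfl⟩
    exact D.conical _ _ x.mul_inv
  · obtain ⟨c, hc⟩ := D'.exists_isRightLcm (MulOpposite.op a) (MulOpposite.op b)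
    exact ⟨c.unop, isRightLcm_op.1 hc⟩

theorem IsAmalgam.finite_dvd_pow (A : IsAmalgam f₁ f₂ h₁ h₂)
    (F₁ : IsFactor h₁) (F₂ : IsFactor h₂) (fin₁ : ∀ a : M₁, {d | d ∣ a}.Finite)
    (fin₂ : ∀ a : M₂, {d | d ∣ a}.Finite) (n : ℕ) : {x | x ∣ f₁ h₁ ^ n}.Finite := by
  have D := A.isDecomposition F₁ F₂
  obtain ⟨inj₁, inj₂⟩ := A.injective F₁ F₂
  refine D.finite_dvd_pow ?_ n
  rintro (_ | _) k
  · rw [A.comm]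
    exact finite_setOf_dvd_map inj₂ (fun {a x} => D.mem_of_mul_mem (b := false) ⟨a, rfl⟩) fin₂ k
  · exact finite_setOf_dvd_map inj₁ (fun {a x} => D.mem_of_mul_mem (b := true) ⟨a, rfl⟩) fin₁ k

end Amalgam

end Garside

theorem mainTheorem1 {M₁ : Type*} {M₂ : Type*} [Monoid M₁] [Monoid M₂]
    (hM₁ : Garside.IsGarsideMonoid M₁) (hM₂ : Garside.IsGarsideMonoid M₂)
    (h₁ : M₁) (h₂ : M₂)
    (root₁ : Garside.IsRootOfGarsideElement h₁) (root₂ : Garside.IsRootOfGarsideElement h₂)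
    (ne₁ : h₁ ≠ 1) (ne₂ : h₂ ≠ 1) :
    Garside.IsGarsideMonoid (Garside.CyclicAmalgam h₁ h₂) ∧
      (Garside.HasFiniteGarsideElement M₁ → Garside.HasFiniteGarsideElement M₂ →
        Garside.HasFiniteGarsideElement (Garside.CyclicAmalgam h₁ h₂)) := by
  have F₁ := hM₁.isFactor root₁ ne₁
  have F₂ := hM₂.isFactor root₂ ne₂
  have A := Garside.cyclicAmalgam_isAmalgam h₁ h₂
  obtain ⟨hM, n, hn⟩ := A.isGarsideMonoid F₁ F₂ root₁ root₂
  exact ⟨hM, fun fin₁ fin₂ =>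
    ⟨_, hn, A.finite_dvd_pow F₁ F₂ (hM₁.finite_dvd fin₁) (hM₂.finite_dvd fin₂) n⟩⟩
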